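/- Let $d\ge 1$, let $A\in\mathbb{R}^{d\times d}$ be symmetric with smallest and largest eigenvalues $\lambda_{\min}$ and $\lambda_{\max}$, let $b\in\mathbb{R}^d$ and $\rho\ge 0$, let $\|\cdot\|$ be the Euclidean norm, and put $$f(x)=\tfrac12 x^{T}Ax+b^{T}x+\tfrac{\rho}{3}\|x\|^3\qquad(x\in\mathbb{R}^d).$$ Let $s$ be a global minimizer of $f$ over $\mathbb{R}^d$. For an integer $t>0$, let $x_t$ be a minimizer of $f$ over the Krylov subspace $\mathcal{K}_t(A,b)=\operatorname{span}\{b,Ab,\ldots,A^{t-1}b\}$. Then for every integer $t>0$, $$f(x_t)-f(s)\le 36\,[f(0)-f(s)]\exp\left\{-4t\sqrt{\frac{\lambda_{\min}+\rho\|s\|}{\lambda_{\max}+\rho\|s\|}}\right\},$$ where the fraction is read as $0$ if its denominator vanishes. Moreover, let $v_{\min}$ be any unit eigenvector of $A$ for $\lambda_{\min}$ and put $b^{(1)}=v_{\min}^{T}b$. If $\lambda_{\min}\ge 0$ or $b^{(1)}\ne 0$, then for every integer $t>0$, $$f(x_t)-f(s)\le\frac{(\lambda_{\max}-\lambda_{\min})\|s\|^2}{(t-\frac12)^2}\left[4+\frac{\mathbb{I}_{\{\lambda_{\min}<0\}}}{8}\log^2\left(\frac{4\|b\|^2}{(b^{(1)})^2}\right)\right],$$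 where the term with $\log^2$ is absent (equal to $0$) if $\lambda_{\min}\ge 0$. -/

import Mathlib

noncomputable section

namespace KrylovCubic

/-- The smallest eigenvalue of a symmetric real matrix of positive size (the spectrum is then a
nonempty finite set of reals, and consists of the eigenvalues). -/
def minEigenvalue {d : ℕ} (A : Matrix (Fin d) (Fin d) ℝ) : ℝ := sInf (spectrum ℝ A)

/-- The largest eigenvalue of a symmetric real matrix of positive size. -/
def maxEigenvalue {d : ℕ} (A : Matrix (Fin d) (Fin d) ℝ) : ℝ := sSup (spectrum ℝ A)

/-- The quadratic `x ↦ (1/2) xᵀ A x + bᵀ x`. -/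
def quadObjective {d : ℕ} (A : Matrix (Fin d) (Fin d) ℝ) (b x : EuclideanSpace ℝ (Fin d)) : ℝ :=
  (1 / 2) * inner ℝ x (A.toEuclideanLin x) + inner ℝ b x

/-- The cubic-regularized quadratic `x ↦ (1/2) xᵀ A x + bᵀ x + (ρ/3) ‖x‖³`. -/
def cubicObjective {d : ℕ} (A : Matrix (Fin d) (Fin d) ℝ) (b : EuclideanSpace ℝ (Fin d)) (ρ : ℝ)
    (x : EuclideanSpace ℝ (Fin d)) : ℝ :=
  quadObjective A b x + ρ / 3 * ‖x‖ ^ 3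

/-- The Krylov subspace `span {b, A b, …, A ^ (t - 1) b}`. -/
def krylovSubspace {d : ℕ} (A : Matrix (Fin d) (Fin d) ℝ) (b : EuclideanSpace ℝ (Fin d)) (t : ℕ) :
    Submodule ℝ (EuclideanSpace ℝ (Fin d)) :=
  Submodule.span ℝ (Set.range fun j : Fin t => (A ^ (j : ℕ)).toEuclideanLin b)

/-- `s` is a global solution of the cubic-regularized problem, a minimizer over the whole space. -/
def IsCubicSolution {d : ℕ} (A : Matrix (Fin d) (Fin d) ℝ) (b : EuclideanSpace ℝ (Fin d)) (ρ : ℝ)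
    (s : EuclideanSpace ℝ (Fin d)) : Prop :=
  ∀ y, cubicObjective A b ρ s ≤ cubicObjective A b ρ y

/-- `x` is an order `t` Krylov subspace solution of the cubic-regularized problem. -/
def IsKrylovCubicSolution {d : ℕ} (A : Matrix (Fin d) (Fin d) ℝ) (b : EuclideanSpace ℝ (Fin d))
    (ρ : ℝ) (t : ℕ) (x : EuclideanSpace ℝ (Fin d)) : Prop :=
  x ∈ krylovSubspace A b t ∧
    ∀ y ∈ krylovSubspace A b t, cubicObjective A b ρ x ≤ cubicObjective A b ρ y

end KrylovCubic

end

namespace KrylovCubic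

open Polynomial

noncomputable section

/-- The Chebyshev polynomials of the fourth kind: `W n (cos 2a) * sin a = sin ((2n+1) a)`. -/
def chebyshevW : ℕ → ℝ[X]
  | 0 => 1
  | 1 => 2 * X + 1
  | n + 2 => 2 * X * chebyshevW (n + 1) - chebyshevW n

theorem natDegree_chebyshevW_le : ∀ n, (chebyshevW n).natDegree ≤ n
  | 0 => by simp [chebyshevW]
  | 1 => by rw [chebyshevW]; compute_degree
  | n + 2 => by
    have h1 := natDegree_chebyshevW_le (n + 1)
    have h0 := natDegree_chebyshevW_le n
    rw [chebyshevW]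
    refine (natDegree_sub_le _ _).trans (max_le ?_ (by omega))
    refine natDegree_mul_le.trans ?_
    have : (2 * X : ℝ[X]).natDegree ≤ 1 := by compute_degree
    omega

theorem chebyshevW_eval_one : ∀ n, (chebyshevW n).eval 1 = 2 * (n : ℝ) + 1
  | 0 => by simp [chebyshevW]
  | 1 => by simp [chebyshevW]
  | n + 2 => by
    have h1 := chebyshevW_eval_one (n + 1)
    have h0 := chebyshevW_eval_one n
    simp only [chebyshevW, eval_sub, eval_mul, eval_X, eval_ofNat, h1, h0]
    push_cast
    ring

theorem chebyshevW_cos (a : ℝ) :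
    ∀ n : ℕ, (chebyshevW n).eval (Real.cos (2 * a)) * Real.sin a = Real.sin ((2 * n + 1) * a)
  | 0 => by simp [chebyshevW]
  | 1 => by
    have : ((2 * ((1 : ℕ) : ℝ) + 1) * a) = 2 * a + a := by push_cast; ring
    rw [this, Real.sin_add, Real.sin_two_mul]
    simp only [chebyshevW, eval_add, eval_mul, eval_X, eval_ofNat, eval_one, Real.cos_two_mul]
    ring
  | n + 2 => by
    have h1 := chebyshevW_cos a (n + 1)
    have h0 := chebyshevW_cos a n
    have e2 : ((2 * ((n + 2 : ℕ) : ℝ) + 1) * a) = (2 * ((n + 1 : ℕ) : ℝ) + 1) * a + 2 * a := by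
      push_cast; ring
    have e0 : ((2 * (n : ℝ) + 1) * a) = (2 * ((n + 1 : ℕ) : ℝ) + 1) * a - 2 * a := by
      push_cast; ring
    rw [e0, Real.sin_sub] at h0
    rw [e2, Real.sin_add]
    simp only [chebyshevW, eval_sub, eval_mul, eval_X, eval_ofNat]
    linear_combination 2 * Real.cos (2 * a) * h1 - h0

theorem chebyshevW_cosh (a : ℝ) :
    ∀ n : ℕ, (chebyshevW n).eval (Real.cosh (2 * a)) * Real.sinh a = Real.sinh ((2 * n + 1) * a)
  | 0 => by simp [chebyshevW]
  | 1 => by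
    have : ((2 * ((1 : ℕ) : ℝ) + 1) * a) = 2 * a + a := by push_cast; ring
    rw [this, Real.sinh_add, Real.sinh_two_mul]
    simp only [chebyshevW, eval_add, eval_mul, eval_X, eval_ofNat, eval_one, Real.cosh_two_mul]
    linear_combination -Real.sinh a * Real.cosh_sq a
  | n + 2 => by
    have h1 := chebyshevW_cosh a (n + 1)
    have h0 := chebyshevW_cosh a n
    have e2 : ((2 * ((n + 2 : ℕ) : ℝ) + 1) * a) = (2 * ((n + 1 : ℕ) : ℝ) + 1) * a + 2 * a := by
      push_cast; ring
    have e0 : ((2 * (n : ℝ) + 1) * a) = (2 * ((n + 1 : ℕ) : ℝ) + 1) * a - 2 * a := by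
      push_cast; ring
    rw [e0, Real.sinh_sub] at h0
    rw [e2, Real.sinh_add]
    simp only [chebyshevW, eval_sub, eval_mul, eval_X, eval_ofNat]
    linear_combination 2 * Real.cosh (2 * a) * h1 - h0

theorem abs_sin_nat_mul_le (n : ℕ) (a : ℝ) : |Real.sin (n * a)| ≤ n * |Real.sin a| := by
  induction n with
  | zero => simp
  | succ n ih =>
    have e : ((n + 1 : ℕ) : ℝ) * a = n * a + a := by push_cast; ring
    rw [e, Real.sin_add]
    have h1 : |Real.sin (n * a) * Real.cos a| ≤ |Real.sin (n * a)| := by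
      rw [abs_mul]; exact mul_le_of_le_one_right (abs_nonneg _) (Real.abs_cos_le_one _)
    have h2 : |Real.cos (n * a) * Real.sin a| ≤ |Real.sin a| := by
      rw [abs_mul]; exact mul_le_of_le_one_left (abs_nonneg _) (Real.abs_cos_le_one _)
    have h3 := abs_add_le (Real.sin (n * a) * Real.cos a) (Real.cos (n * a) * Real.sin a)
    push_cast
    linarith

theorem exists_eq_cos_two_mul {w : ℝ} (h1 : -1 ≤ w) (h2 : w ≤ 1) : ∃ a, w = Real.cos (2 * a) :=
  ⟨Real.arccos w / 2, by rw [mul_div_cancel₀ _ (two_ne_zero), Real.cos_arccos h1 h2]⟩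

theorem chebyshevW_eval_sq_le {w : ℝ} (h1 : -1 ≤ w) (h2 : w ≤ 1) (n : ℕ) :
    (chebyshevW n).eval w ^ 2 ≤ (2 * (n : ℝ) + 1) ^ 2 := by
  obtain ⟨a, rfl⟩ := exists_eq_cos_two_mul h1 h2
  by_cases hs : Real.sin a = 0
  · have : Real.cos (2 * a) = 1 := by
      rw [Real.cos_two_mul, Real.cos_sq', hs]; norm_num
    rw [this, chebyshevW_eval_one]
  · have h := chebyshevW_cos a n
    have hb := abs_sin_nat_mul_le (2 * n + 1) a
    push_cast at hb
    rw [← h, abs_mul] at hb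
    have := le_of_mul_le_mul_right hb (abs_pos.mpr hs)
    exact sq_le_sq' (by linarith [neg_abs_le ((chebyshevW n).eval (Real.cos (2 * a)))])
      ((le_abs_self _).trans this)

theorem one_sub_mul_chebyshevW_eval_sq_le {w : ℝ} (h1 : -1 ≤ w) (h2 : w ≤ 1) (n : ℕ) :
    (1 - w) / 2 * (chebyshevW n).eval w ^ 2 ≤ 1 := by
  obtain ⟨a, rfl⟩ := exists_eq_cos_two_mul h1 h2
  have h := chebyshevW_cos a n
  have e : (1 - Real.cos (2 * a)) / 2 = Real.sin a ^ 2 := by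
    rw [Real.cos_two_mul, Real.sin_sq]; ring
  rw [e, ← mul_pow, mul_comm, h]
  exact Real.sin_sq_le_one _

theorem sinh_le_self_mul_cosh {x : ℝ} (hx : 0 ≤ x) : Real.sinh x ≤ x * Real.cosh x := by
  have hd : ∀ y : ℝ, HasDerivAt (fun y => y * Real.cosh y - Real.sinh y) (y * Real.sinh y) y := by
    intro y
    have := ((hasDerivAt_id y).mul (Real.hasDerivAt_cosh y)).sub (Real.hasDerivAt_sinh y)
    convert! this using 1
    simp
  have hm : MonotoneOn (fun y => y * Real.cosh y - Real.sinh y) (Set.Ici 0) := by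
    refine monotoneOn_of_deriv_nonneg (convex_Ici 0)
      (fun y _ => (hd y).continuousAt.continuousWithinAt)
      (fun y _ => (hd y).differentiableAt.differentiableWithinAt) ?_
    intro y hy
    rw [interior_Ici, Set.mem_Ioi] at hy
    rw [(hd y).deriv]
    exact mul_nonneg hy.le (Real.sinh_nonneg_iff.mpr hy.le)
  have := hm Set.self_mem_Ici hx hx
  simp at this
  linarith

theorem exp_div_two_le_cosh (x : ℝ) : Real.exp x / 2 ≤ Real.cosh x := by
  rw [Real.cosh_eq]
  linarith [Real.exp_pos (-x)]

/-- The Chebyshev polynomial of an interval `[α, β]`, in the variable `z - lam`, normalized at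
`z = 0`. -/
theorem exists_chebyshev_small (m M lam : ℝ) (hmM : m ≤ M) (hpos : 0 < m + lam) {t : ℕ}
    (ht : 0 < t) : ∃ r : ℝ[X], r.natDegree ≤ t ∧ r.eval (-lam) = 1 ∧
      ∀ x, m ≤ x → x ≤ M →
        |r.eval x| ≤ 2 * Real.exp (-2 * t * √((m + lam) / (M + lam))) := by
  rcases hmM.eq_or_lt with rfl | hlt
  · refine ⟨C (m + lam)⁻¹ * (C m - X), ?_, ?_, ?_⟩
    · refine le_trans ?_ (show 1 ≤ t from ht)
      compute_degree
    · simp; field_simp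
    · intro x h1 h2
      have : x = m := le_antisymm h2 h1
      subst this
      simp
      positivity
  · set u := √((m + lam) / (M + lam)) with hu
    have hM : 0 < M + lam := by linarith
    have hu2 : u ^ 2 = (m + lam) / (M + lam) := Real.sq_sqrt (by positivity)
    have hu0 : 0 < u := Real.sqrt_pos.mpr (by positivity)
    have hu1 : u < 1 := by
      have : u ^ 2 < 1 := by rw [hu2, div_lt_one hM]; linarith
      nlinarith
    set a := Real.artanh u
    have hmem : u ∈ Set.Ioo (-1 : ℝ) 1 := ⟨by linarith, hu1⟩
    have ha0 : 0 < a := Real.artanh_pos ⟨hu0, hu1⟩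
    have hch : Real.cosh a ^ 2 = 1 / (1 - u ^ 2) := by
      rw [Real.cosh_artanh hmem, div_pow, Real.sq_sqrt (by nlinarith), one_pow]
    have hua : u ≤ a := by
      have h := sinh_le_self_mul_cosh ha0.le
      have h2 := Real.tanh_artanh hmem
      rw [Real.tanh_eq_sinh_div_cosh] at h2
      rw [← h2, div_le_iff₀ (Real.cosh_pos _)]
      exact h
    set D : ℝ := (Chebyshev.T ℝ t).eval (Real.cosh (2 * a)) with hD
    have hDge : Real.exp (2 * t * u) / 2 ≤ D := by
      rw [hD, Chebyshev.T_real_cosh]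
      refine le_trans ?_ (exp_div_two_le_cosh _)
      have : (0 : ℝ) ≤ t := by positivity
      have : 2 * t * u ≤ ((t : ℕ) : ℤ) * (2 * a) := by push_cast; nlinarith
      gcongr
    have hD0 : 0 < D := lt_of_lt_of_le (by positivity) hDge
    have hMm : M - m ≠ 0 := by linarith
    have hcosh : Real.cosh (2 * a) = (m + M + 2 * lam) / (M - m) := by
      rw [Real.cosh_two_mul, Real.sinh_sq, hch, hu2]
      have : 1 - (m + lam) / (M + lam) = (M - m) / (M + lam) := by field_simp; ring
      rw [this]
      field_simp
      ring
    refine ⟨C D⁻¹ * (Chebyshev.T ℝ t).comp (C ((m + M) / (M - m)) - C (2 / (M - m)) * X),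
      ?_, ?_, ?_⟩
    · refine (natDegree_C_mul_le _ _).trans (natDegree_comp_le.trans ?_)
      rw [Chebyshev.natDegree_T]
      have : (C ((m + M) / (M - m)) - C (2 / (M - m)) * X : ℝ[X]).natDegree ≤ 1 := by
        compute_degree
      simpa using Nat.mul_le_mul_left t this
    · have : (m + M) / (M - m) - 2 / (M - m) * (-lam) = Real.cosh (2 * a) := by
        rw [hcosh]; field_simp; ring
      simp only [eval_mul, eval_C, eval_comp, eval_sub, eval_X, this, ← hD]
      field_simp
    · intro x h1 h2
      simp only [eval_mul, eval_C, eval_comp, eval_sub, eval_X]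
      have hw : |(m + M) / (M - m) - 2 / (M - m) * x| ≤ 1 := by
        have e : (m + M) / (M - m) - 2 / (M - m) * x = (m + M - 2 * x) / (M - m) := by ring
        rw [e, abs_div, abs_of_pos (sub_pos.mpr hlt), div_le_one (sub_pos.mpr hlt), abs_le]
        constructor <;> linarith
      have hT := Chebyshev.abs_eval_T_real_le_one t hw
      rw [abs_mul, abs_of_pos (inv_pos.mpr hD0)]
      refine (mul_le_of_le_one_right (inv_pos.mpr hD0).le hT).trans ?_
      rw [show -2 * (t : ℝ) * u = -(2 * t * u) by ring, Real.exp_neg]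
      rw [inv_le_comm₀ hD0 (by positivity)]
      rw [mul_inv, inv_inv]
      linarith

theorem sub_half_sq_le_two_pow (t : ℕ) (ht : 0 < t) : ((t : ℝ) - 1 / 2) ^ 2 ≤ 4 * 2 ^ (t - 1) := by
  have h : ∀ n : ℕ, ((n : ℝ) + 1) ^ 2 ≤ 4 * 2 ^ n := by
    intro n
    induction n using Nat.strong_induction_on with
    | _ n ih =>
      match n with
      | 0 => norm_num
      | 1 => norm_num
      | 2 => norm_num
      | k + 3 =>
        have := ih (k + 2) (by omega)
        rw [show k + 3 = (k + 2) + 1 from rfl, pow_succ (2 : ℝ)]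
        push_cast at this ⊢
        have : (0 : ℝ) ≤ k := by positivity
        nlinarith
  have h1 := h (t - 1)
  have h2 : ((t - 1 : ℕ) : ℝ) = t - 1 := by rw [Nat.cast_sub ht]; simp
  rw [h2] at h1
  have : (1 : ℝ) ≤ t := by exact_mod_cast ht
  nlinarith

/-- A polynomial with values in `[0, 1]` on `[m, M]`, equal to one at `-lam`, for which
`(x + lam) * r x` is `O(L / t ^ 2)`. -/
theorem exists_fejer_polynomial (m M lam L : ℝ) (hL : 0 < L) (hML : M - m ≤ L)
    (hnn : 0 ≤ m + lam) {t : ℕ} (ht : 0 < t) :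
    ∃ r : ℝ[X], r.natDegree ≤ t ∧ r.eval (-lam) = 1 ∧
      ∀ x, m ≤ x → x ≤ M → 0 ≤ r.eval x ∧ r.eval x ≤ 1 ∧
        (x + lam) * r.eval x ≤ 4 * L / ((t : ℝ) - 1 / 2) ^ 2 := by
  have ht1 : (1 : ℝ) ≤ t := by exact_mod_cast ht
  have hth : 0 < (t : ℝ) - 1 / 2 := by linarith
  set B := L + (m + lam) with hB
  have hB0 : 0 < B := by linarith
  rcases le_total (m + lam) L with hc | hc
  · set k := t / 2
    have hk : (t : ℝ) ≤ 2 * (k : ℝ) + 1 := by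
      have : t ≤ 2 * k + 1 := by omega
      exact_mod_cast this
    have hk0 : (0 : ℝ) < 2 * (k : ℝ) + 1 := by positivity
    set q : ℝ[X] := C (1 - 2 * lam / B) - C (2 / B) * X with hq
    have hqe : ∀ x, q.eval x = 1 - 2 * (x + lam) / B := by
      intro x; simp [hq]; ring
    refine ⟨(C (2 * (k : ℝ) + 1)⁻¹ * (chebyshevW k).comp q) ^ 2, ?_, ?_, ?_⟩
    · have h1 : q.natDegree ≤ 1 := by rw [hq]; compute_degree
      have h2 := natDegree_chebyshevW_le k
      have h3 : (C (2 * (k : ℝ) + 1)⁻¹ * (chebyshevW k).comp q).natDegree ≤ k := by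
        refine (natDegree_C_mul_le _ _).trans (natDegree_comp_le.trans ?_)
        nlinarith
      refine natDegree_pow_le.trans ?_
      omega
    · simp only [eval_pow, eval_mul, eval_C, eval_comp, hqe]
      rw [show 1 - 2 * (-lam + lam) / B = 1 by simp, chebyshevW_eval_one]
      field_simp
    · intro x h1 h2
      simp only [eval_pow, eval_mul, eval_C, eval_comp, hqe]
      set w := 1 - 2 * (x + lam) / B with hw
      have hz : x + lam = B * ((1 - w) / 2) := by rw [hw]; field_simp; ring
      have hw1 : -1 ≤ w := by
        have : (x + lam) / B ≤ 1 := by rw [div_le_one hB0]; linarith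
        rw [hw, mul_div_assoc]; linarith
      have hw2 : w ≤ 1 := by
        have : 0 ≤ (x + lam) / B := div_nonneg (by linarith) hB0.le
        rw [hw, mul_div_assoc]; linarith
      refine ⟨sq_nonneg _, ?_, ?_⟩
      · rw [mul_pow, inv_pow, inv_mul_le_iff₀ (by positivity), mul_one]
        exact chebyshevW_eval_sq_le hw1 hw2 k
      · have h3 := one_sub_mul_chebyshevW_eval_sq_le hw1 hw2 k
        have e : (x + lam) * ((2 * (k : ℝ) + 1)⁻¹ * eval w (chebyshevW k)) ^ 2
            = B * ((1 - w) / 2 * eval w (chebyshevW k) ^ 2) / (2 * (k : ℝ) + 1) ^ 2 := by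
          rw [hz]; field_simp
        rw [e]
        refine div_le_div₀ (by positivity) ?_ (by positivity) ?_
        · nlinarith
        · exact pow_le_pow_left₀ hth.le (by linarith) 2
  · refine ⟨(C (1 - lam / B) - C (1 / B) * X) ^ t, ?_, ?_, ?_⟩
    · refine natDegree_pow_le.trans ?_
      have : (C (1 - lam / B) - C (1 / B) * X : ℝ[X]).natDegree ≤ 1 := by compute_degree
      nlinarith
    · simp only [eval_pow, eval_sub, eval_mul, eval_C, eval_X]
      rw [show 1 - lam / B - 1 / B * -lam = 1 by ring, one_pow]
    · intro x h1 h2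
      simp only [eval_pow, eval_sub, eval_mul, eval_C, eval_X]
      have e : 1 - lam / B - 1 / B * x = (B - (x + lam)) / B := by field_simp; ring
      rw [e]
      set v := (B - (x + lam)) / B with hv
      have hv0 : 0 ≤ v := div_nonneg (by linarith) hB0.le
      have hv1 : v ≤ L / B := by rw [hv]; gcongr; linarith
      have hLB : L / B ≤ 1 / 2 := by rw [div_le_iff₀ hB0]; linarith
      refine ⟨by positivity, pow_le_one₀ hv0 (by linarith), ?_⟩
      have h3 : (x + lam) * v ^ t ≤ L * (1 / 2) ^ (t - 1) := by
        obtain ⟨k, rfl⟩ : ∃ k, t = k + 1 := ⟨t - 1, by omega⟩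
        rw [pow_succ, Nat.add_sub_cancel]
        have h4 : (x + lam) * v ≤ L := by
          calc (x + lam) * v ≤ B * (L / B) := by
                apply mul_le_mul (by linarith) hv1 hv0 hB0.le
            _ = L := by field_simp
        have h5 : v ^ k ≤ (1 / 2) ^ k := pow_le_pow_left₀ hv0 (by linarith) k
        calc (x + lam) * (v ^ k * v) = ((x + lam) * v) * v ^ k := by ring
          _ ≤ L * (1 / 2) ^ k := by
            apply mul_le_mul h4 h5 (by positivity) hL.le
      refine h3.trans ?_
      rw [le_div_iff₀ (by positivity), one_div, inv_pow]
      have h6 := sub_half_sq_le_two_pow t ht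
      have h7 : (0 : ℝ) < 2 ^ (t - 1) := by positivity
      rw [mul_assoc, mul_comm 4 L]
      gcongr
      rw [inv_mul_le_iff₀ h7]
      linarith

/-- Chebyshev amplification of the lower end of `[m, M]`: for a polynomial `p` of degree less than
`t`, the weight `(x - m - δ) * p x ^ 2` is at most one on the interval, and below `1 - β` at `m`. -/
theorem exists_amplifying_polynomial (m M L β : ℝ) (hL : 0 < L) (hML : M - m ≤ L) (hβ : 1 ≤ β)
    {t : ℕ} (ht : 0 < t) :
    ∃ δ : ℝ, δ ≤ L * Real.log (4 * β) ^ 2 / (16 * ((t : ℝ) - 1 / 2) ^ 2) ∧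
      ∃ p : ℝ[X], p.natDegree < t ∧ p.eval m ≠ 0 ∧ (m - m - δ) * p.eval m ^ 2 ≤ 1 - β ∧
        ∀ x, m ≤ x → x ≤ M → (x - m - δ) * p.eval x ^ 2 ≤ 1 := by
  have ht1 : (1 : ℝ) ≤ t := by exact_mod_cast ht
  obtain ⟨k, rfl⟩ : ∃ k, t = k + 1 := ⟨t - 1, by omega⟩
  push_cast at ht1 ⊢
  set l := Real.log (4 * β) with hl
  have hl0 : 0 < l := Real.log_pos (by linarith)
  have hk0 : (0 : ℝ) < 2 * k + 1 := by positivity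
  set a := l / (2 * (2 * k + 1)) with ha
  have ha0 : 0 < a := by positivity
  have hka : (2 * k + 1) * a = l / 2 := by rw [ha]; field_simp
  have hca := Real.cosh_pos a
  have hc2 := Real.cosh_sq a
  set δ := L * (Real.sinh a / Real.cosh a) ^ 2 with hδ
  set K := L / Real.cosh a ^ 2 with hK
  have hK0 : 0 < K := by positivity
  have hLδ : L - δ = K := by
    rw [hδ, hK, div_pow]; field_simp; linarith
  have hδK : δ = K * Real.sinh a ^ 2 := by rw [hδ, hK]; field_simp
  have hs0 : 0 < Real.sinh a := Real.sinh_pos_iff.mpr ha0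
  refine ⟨δ, ?_, C (√K)⁻¹ * (chebyshevW k).comp (C (1 + 2 * (m + δ) / K) - C (2 / K) * X), ?_, ?_⟩
  · have h1 : Real.sinh a / Real.cosh a ≤ a := by
      rw [div_le_iff₀ hca]; exact sinh_le_self_mul_cosh ha0.le
    have h2 : (Real.sinh a / Real.cosh a) ^ 2 ≤ a ^ 2 := pow_le_pow_left₀ (by positivity) h1 2
    calc δ ≤ L * a ^ 2 := by rw [hδ]; gcongr
      _ = _ := by
        rw [ha, show ((k : ℝ) + 1 - 1 / 2) = (2 * k + 1) / 2 by ring]; field_simp; norm_num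
  · have h1 : (C (1 + 2 * (m + δ) / K) - C (2 / K) * X : ℝ[X]).natDegree ≤ 1 := by compute_degree
    have h2 := natDegree_chebyshevW_le k
    refine lt_of_le_of_lt ((natDegree_C_mul_le _ _).trans natDegree_comp_le) ?_
    nlinarith
  · have hev : ∀ x, (C (√K)⁻¹ * (chebyshevW k).comp
        (C (1 + 2 * (m + δ) / K) - C (2 / K) * X)).eval x
          = (√K)⁻¹ * (chebyshevW k).eval (1 - 2 * (x - m - δ) / K) := by
      intro x
      simp only [eval_mul, eval_C, eval_comp, eval_sub, eval_X]
      congr 2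
      ring
    have hm : 1 - 2 * (m - m - δ) / K = Real.cosh (2 * a) := by
      rw [Real.cosh_two_mul, hc2, hδK]; field_simp; ring
    have hW := chebyshevW_cosh a k
    rw [hka] at hW
    have hsl : 0 < Real.sinh (l / 2) := Real.sinh_pos_iff.mpr (by positivity)
    have hsK : √K ^ 2 = K := Real.sq_sqrt hK0.le
    simp only [hev]
    refine ⟨?_, ?_, ?_⟩
    · rw [hm]
      refine mul_ne_zero (inv_ne_zero (Real.sqrt_pos.mpr hK0).ne') ?_
      intro h
      rw [h, zero_mul] at hW
      exact hsl.ne hW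
    · rw [hm, mul_pow, inv_pow, hsK, hδK]
      have h1 : (m - m - K * Real.sinh a ^ 2) * (K⁻¹ * eval (Real.cosh (2 * a)) (chebyshevW k) ^ 2)
          = -Real.sinh (l / 2) ^ 2 := by
        rw [← hW]; field_simp; ring
      rw [h1]
      have h2 := Real.cosh_sq (l / 2)
      have h3 := exp_div_two_le_cosh (l / 2)
      have h4 : (Real.exp (l / 2) / 2) ^ 2 = β := by
        rw [div_pow, ← Real.exp_nat_mul]
        push_cast
        rw [mul_div_cancel₀ _ two_ne_zero, hl, Real.exp_log (by linarith)]
        ring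
      have h5 := pow_le_pow_left₀ (by positivity) h3 2
      linarith
    · intro x h1 h2
      rw [mul_pow, inv_pow, hsK]
      set w := 1 - 2 * (x - m - δ) / K with hw
      have hz : x - m - δ = K * ((1 - w) / 2) := by rw [hw]; field_simp; ring
      rcases le_total w 1 with hw2 | hw2
      · have hw1 : -1 ≤ w := by
          have : (x - m - δ) / K ≤ 1 := by rw [div_le_one hK0]; linarith
          rw [hw, mul_div_assoc]; linarith
        have := one_sub_mul_chebyshevW_eval_sq_le hw1 hw2 k
        rw [hz]
        calc _ = (1 - w) / 2 * eval w (chebyshevW k) ^ 2 := by field_simp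
          _ ≤ 1 := this
      · rw [hz]
        refine le_trans (mul_nonpos_of_nonpos_of_nonneg ?_ (by positivity)) zero_le_one
        exact mul_nonpos_of_nonneg_of_nonpos hK0.le (by linarith)

section Operator

variable {E : Type*} [NormedAddCommGroup E] [InnerProductSpace ℝ E]

theorem aeval_apply_of_eigen (T : Module.End ℝ E) {c : ℝ} {v : E} (h : T v = c • v) (p : ℝ[X]) :
    aeval T p v = p.eval c • v := by
  rcases eq_or_ne v 0 with rfl | hv
  · simp
  · exact Module.End.aeval_apply_of_hasEigenvector
      ⟨Module.End.mem_eigenspace_iff.mpr h, hv⟩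

theorem isSymmetric_aeval {T : Module.End ℝ E} (hT : T.IsSymmetric) (p : ℝ[X]) (x y : E) :
    inner ℝ (aeval T p x) y = inner ℝ x (aeval T p y) := by
  induction p using Polynomial.induction_on' generalizing x y with
  | add p q hp hq => simp [inner_add_left, inner_add_right, hp, hq]
  | monomial n a =>
    simp only [aeval_monomial, Module.End.mul_apply, Module.algebraMap_end_apply, inner_smul_left,
      inner_smul_right]
    congr 1
    exact hT.pow n x y

theorem inner_aeval_aeval {T : Module.End ℝ E} (hT : T.IsSymmetric) (p q : ℝ[X]) (x : E) :
    inner ℝ (aeval T p x) (aeval T q x) = inner ℝ x (aeval T (p * q) x) := by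
  rw [isSymmetric_aeval hT, map_mul, Module.End.mul_apply]

theorem norm_sq_aeval {T : Module.End ℝ E} (hT : T.IsSymmetric) (p : ℝ[X]) (x : E) :
    ‖aeval T p x‖ ^ 2 = inner ℝ x (aeval T (p * p) x) := by
  rw [← inner_aeval_aeval hT, real_inner_self_eq_norm_sq]

theorem inner_aeval_nonneg_of_basis {ι : Type*} [Fintype ι] (e : OrthonormalBasis ι ℝ E)
    {T : Module.End ℝ E} (hT : T.IsSymmetric) (μ : ι → ℝ) (h : ∀ i, T (e i) = μ i • e i)
    (p : ℝ[X]) (hp : ∀ i, 0 ≤ p.eval (μ i)) (x : E) : 0 ≤ inner ℝ x (aeval T p x) := by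
  rw [← e.sum_inner_mul_inner]
  refine Finset.sum_nonneg fun i _ => ?_
  rw [← isSymmetric_aeval hT, aeval_apply_of_eigen T (h i), real_inner_smul_left,
    real_inner_comm]
  have := mul_nonneg (hp i) (mul_self_nonneg (inner ℝ (e i) x))
  linarith

end Operator

variable {d : ℕ}

/-- The endomorphism of Euclidean space given by a matrix. -/
abbrev toEnd (A : Matrix (Fin d) (Fin d) ℝ) : Module.End ℝ (EuclideanSpace ℝ (Fin d)) :=
  A.toEuclideanLin

theorem toEnd_isSymmetric {A : Matrix (Fin d) (Fin d) ℝ} (hA : A.IsSymm) :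
    (toEnd A).IsSymmetric :=
  Matrix.isSymmetric_toEuclideanLin_iff.mpr (by
    rw [Matrix.IsHermitian, Matrix.conjTranspose_eq_transpose_of_trivial]; exact hA)

theorem exists_eigenbasis {A : Matrix (Fin d) (Fin d) ℝ} (hA : A.IsSymm) :
    ∃ (e : OrthonormalBasis (Fin d) ℝ (EuclideanSpace ℝ (Fin d))) (μ : Fin d → ℝ),
      (∀ i, toEnd A (e i) = μ i • e i) ∧ spectrum ℝ A = Set.range μ := by
  have h : A.IsHermitian := by
    rw [Matrix.IsHermitian, Matrix.conjTranspose_eq_transpose_of_trivial]; exact hA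
  refine ⟨h.eigenvectorBasis, h.eigenvalues, fun i => ?_, h.spectrum_real_eq_range_eigenvalues⟩
  have := h.mulVec_eigenvectorBasis i
  ext j
  simpa [toEnd, Matrix.toLpLin_apply] using congrFun this j

theorem inner_aeval_nonneg {A : Matrix (Fin d) (Fin d) ℝ} (hA : A.IsSymm) (p : ℝ[X])
    (hp : ∀ x, minEigenvalue A ≤ x → x ≤ maxEigenvalue A → 0 ≤ p.eval x)
    (v : EuclideanSpace ℝ (Fin d)) : 0 ≤ inner ℝ v (aeval (toEnd A) p v) := by
  obtain ⟨e, μ, he, hμ⟩ := exists_eigenbasis hA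
  have hfin : (Set.range μ).Finite := Set.finite_range μ
  refine inner_aeval_nonneg_of_basis e (toEnd_isSymmetric hA) μ he p (fun i => hp _ ?_ ?_) v
  · rw [minEigenvalue, hμ]; exact csInf_le hfin.bddBelow ⟨i, rfl⟩
  · rw [maxEigenvalue, hμ]; exact le_csSup hfin.bddAbove ⟨i, rfl⟩

theorem inner_aeval_le {A : Matrix (Fin d) (Fin d) ℝ} (hA : A.IsSymm) (p q : ℝ[X])
    (hp : ∀ x, minEigenvalue A ≤ x → x ≤ maxEigenvalue A → p.eval x ≤ q.eval x)
    (v : EuclideanSpace ℝ (Fin d)) :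
    inner ℝ v (aeval (toEnd A) p v) ≤ inner ℝ v (aeval (toEnd A) q v) := by
  have := inner_aeval_nonneg hA (q - p)
    (fun x h1 h2 => by rw [eval_sub]; linarith [hp x h1 h2]) v
  rw [map_sub, LinearMap.sub_apply, inner_sub_right] at this
  linarith

theorem inner_aeval_le_const {A : Matrix (Fin d) (Fin d) ℝ} (hA : A.IsSymm) (p : ℝ[X]) (c : ℝ)
    (hp : ∀ x, minEigenvalue A ≤ x → x ≤ maxEigenvalue A → p.eval x ≤ c)
    (v : EuclideanSpace ℝ (Fin d)) :
    inner ℝ v (aeval (toEnd A) p v) ≤ c * ‖v‖ ^ 2 := by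
  have := inner_aeval_le hA p (C c) (by simpa using hp) v
  rwa [aeval_C, Module.algebraMap_end_apply, real_inner_smul_right,
    real_inner_self_eq_norm_sq] at this

theorem minEigenvalue_le_maxEigenvalue (hd : 0 < d) {A : Matrix (Fin d) (Fin d) ℝ}
    (hA : A.IsSymm) : minEigenvalue A ≤ maxEigenvalue A := by
  obtain ⟨e, μ, he, hμ⟩ := exists_eigenbasis hA
  have hfin : (Set.range μ).Finite := Set.finite_range μ
  have h1 : minEigenvalue A ≤ μ ⟨0, hd⟩ := by
    rw [minEigenvalue, hμ]; exact csInf_le hfin.bddBelow ⟨_, rfl⟩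
  refine h1.trans ?_
  rw [maxEigenvalue, hμ]; exact le_csSup hfin.bddAbove ⟨_, rfl⟩

theorem minEigenvalue_add_nonneg (hd : 0 < d) {A : Matrix (Fin d) (Fin d) ℝ} (hA : A.IsSymm)
    {c : ℝ} (h : ∀ u : EuclideanSpace ℝ (Fin d), 0 ≤ inner ℝ u (toEnd A u + c • u)) :
    0 ≤ minEigenvalue A + c := by
  obtain ⟨e, μ, he, hμ⟩ := exists_eigenbasis hA
  have : -c ≤ minEigenvalue A := by
    rw [minEigenvalue, hμ]
    refine le_csInf ⟨μ ⟨0, hd⟩, _, rfl⟩ ?_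
    rintro _ ⟨i, rfl⟩
    have := h (e i)
    rw [he, ← add_smul, real_inner_smul_right, real_inner_self_eq_norm_sq, e.norm_eq_one] at this
    linarith
  linarith

theorem aeval_mem_krylovSubspace (A : Matrix (Fin d) (Fin d) ℝ) (b : EuclideanSpace ℝ (Fin d))
    {t : ℕ} {p : ℝ[X]} (hp : p.natDegree < t) :
    aeval (toEnd A) p b ∈ krylovSubspace A b t := by
  rw [aeval_eq_sum_range' hp, LinearMap.sum_apply]
  refine Submodule.sum_mem _ fun i hi => ?_
  rw [LinearMap.smul_apply]
  refine Submodule.smul_mem _ _ (Submodule.subset_span ⟨⟨i, Finset.mem_range.mp hi⟩, ?_⟩)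
  exact congrArg (fun S : Module.End ℝ (EuclideanSpace ℝ (Fin d)) => S b)
    (map_pow (Matrix.toLpLinAlgEquiv (R := ℝ) (n := Fin d) 2) A i)

theorem sub_aeval_mem_krylovSubspace {A : Matrix (Fin d) (Fin d) ℝ}
    {b s : EuclideanSpace ℝ (Fin d)} {lam : ℝ} (hs : toEnd A s + lam • s = -b) {t : ℕ}
    (ht : 0 < t) {r : ℝ[X]} (hr : r.natDegree ≤ t) (hr1 : r.eval (-lam) = 1) :
    s - aeval (toEnd A) r s ∈ krylovSubspace A b t := by
  obtain ⟨p, hp⟩ : X - C (-lam) ∣ 1 - r := dvd_iff_isRoot.mpr (by simp [hr1])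
  have hdeg : p.natDegree < t := by
    rcases eq_or_ne p 0 with rfl | hp0
    · simpa
    · have h1 : (1 - r).natDegree ≤ t :=
        (natDegree_sub_le _ _).trans (by simpa using hr)
      rw [hp, natDegree_mul (X_sub_C_ne_zero _) hp0, natDegree_X_sub_C] at h1
      omega
  have e : s - aeval (toEnd A) r s = aeval (toEnd A) (-p) b := by
    have h1 : s - aeval (toEnd A) r s = aeval (toEnd A) (p * (X - C (-lam))) s := by
      rw [mul_comm, ← hp, map_sub, map_one, LinearMap.sub_apply, Module.End.one_apply]
    have h2 : aeval (toEnd A) (X - C (-lam)) s = -b := by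
      rw [← hs]; simp
    rw [h1, map_mul, Module.End.mul_apply, h2]
    simp
  rw [e]
  exact aeval_mem_krylovSubspace A b (by rwa [natDegree_neg])

theorem cubicObjective_sub {A : Matrix (Fin d) (Fin d) ℝ} (hA : A.IsSymm)
    (b : EuclideanSpace ℝ (Fin d)) (ρ : ℝ) (s u : EuclideanSpace ℝ (Fin d)) :
    cubicObjective A b ρ (s + u) - cubicObjective A b ρ s =
      1 / 2 * inner ℝ u (toEnd A u + (ρ * ‖s‖) • u)
        + inner ℝ (toEnd A s + (ρ * ‖s‖) • s + b) u
        + ρ * (‖s + u‖ - ‖s‖) ^ 2 * (2 * ‖s + u‖ + ‖s‖) / 6 := by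
  have h1 := norm_add_sq_real s u
  have h2 : inner ℝ u (toEnd A s) = inner ℝ (toEnd A s) u := real_inner_comm _ _
  have h3 : inner ℝ s (toEnd A u) = inner ℝ (toEnd A s) u := (toEnd_isSymmetric hA s u).symm
  simp only [cubicObjective, quadObjective, map_add, inner_add_left, inner_add_right,
    real_inner_smul_left, real_inner_smul_right, real_inner_self_eq_norm_sq] at *
  rw [h2, h3]
  linear_combination (ρ * ‖s‖ / 2) * h1

theorem nonpos_of_forall_le_mul {a c : ℝ} (h : ∀ τ, 0 < τ → τ ≤ 1 → a ≤ c * τ) : a ≤ 0 := by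
  by_contra! ha
  have hc := abs_nonneg c
  have hpos : 0 < a + |c| := by linarith
  have h1 := h (a / (a + |c|)) (by positivity) (by rw [div_le_one hpos]; linarith)
  have h2 : c * (a / (a + |c|)) ≤ |c| * (a / (a + |c|)) :=
    mul_le_mul_of_nonneg_right (le_abs_self c) (by positivity)
  have h3 : |c| * (a / (a + |c|)) < a := by
    rw [← mul_div_assoc, div_lt_iff₀ hpos]; nlinarith
  linarith

variable {A : Matrix (Fin d) (Fin d) ℝ} {b s : EuclideanSpace ℝ (Fin d)} {ρ : ℝ}

theorem cubic_remainder_le (hρ : 0 ≤ ρ) (s u : EuclideanSpace ℝ (Fin d)) :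
    ρ * (‖s + u‖ - ‖s‖) ^ 2 * (2 * ‖s + u‖ + ‖s‖) / 6 ≤
      ρ * ‖u‖ ^ 2 * (3 * ‖s‖ + 2 * ‖u‖) / 6 := by
  have h1 : (‖s + u‖ - ‖s‖) ^ 2 ≤ ‖u‖ ^ 2 := by
    have := abs_norm_sub_norm_le (s + u) s
    rw [add_sub_cancel_left] at this
    rw [← sq_abs]
    exact pow_le_pow_left₀ (abs_nonneg _) this 2
  have h2 := norm_add_le s u
  have h3 : 2 * ‖s + u‖ + ‖s‖ ≤ 3 * ‖s‖ + 2 * ‖u‖ := by linarith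
  gcongr ρ * ?_ * ?_ / 6

theorem IsCubicSolution.stationary (hA : A.IsSymm) (hρ : 0 ≤ ρ) (hs : IsCubicSolution A b ρ s) :
    toEnd A s + (ρ * ‖s‖) • s = -b := by
  set G := toEnd A s + (ρ * ‖s‖) • s + b with hG
  suffices ‖G‖ ^ 2 ≤ 0 by
    have h0 : G = 0 := by
      rw [← norm_eq_zero]; exact pow_eq_zero_iff (two_ne_zero) |>.mp (le_antisymm this (sq_nonneg _))
    exact eq_neg_of_add_eq_zero_left h0
  refine nonpos_of_forall_le_mul (c := 1 / 2 * inner ℝ G (toEnd A G + (ρ * ‖s‖) • G)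
    + ρ * ‖G‖ ^ 2 * (3 * ‖s‖ + 2 * ‖G‖) / 6) fun τ h0 h1 => ?_
  have h2 := cubicObjective_sub hA b ρ s (-(τ • G))
  have h3 := hs (s + -(τ • G))
  have h4 := cubic_remainder_le hρ s (-(τ • G))
  rw [← hG] at h2
  have e1 : inner ℝ (-(τ • G)) (toEnd A (-(τ • G)) + (ρ * ‖s‖) • (-(τ • G)))
      = τ ^ 2 * inner ℝ G (toEnd A G + (ρ * ‖s‖) • G) := by
    have : toEnd A (-(τ • G)) + (ρ * ‖s‖) • (-(τ • G))
        = (-τ) • (toEnd A G + (ρ * ‖s‖) • G) := by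
      rw [map_neg, map_smul]; module
    rw [this, ← neg_smul, real_inner_smul_left, real_inner_smul_right]; ring
  have e2 : inner ℝ G (-(τ • G)) = -(τ * ‖G‖ ^ 2) := by
    rw [inner_neg_right, real_inner_smul_right, real_inner_self_eq_norm_sq]
  have e3 : ‖-(τ • G)‖ = τ * ‖G‖ := by
    rw [norm_neg, norm_smul, Real.norm_of_nonneg h0.le]
  rw [e3] at h4
  rw [e1, e2] at h2
  have h5 : ρ * (τ * ‖G‖) ^ 2 * (3 * ‖s‖ + 2 * (τ * ‖G‖)) / 6
      ≤ τ ^ 2 * (ρ * ‖G‖ ^ 2 * (3 * ‖s‖ + 2 * ‖G‖) / 6) := by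
    have : τ * ‖G‖ ≤ ‖G‖ := mul_le_of_le_one_left (norm_nonneg _) h1
    calc _ ≤ ρ * (τ * ‖G‖) ^ 2 * (3 * ‖s‖ + 2 * ‖G‖) / 6 := by gcongr
      _ = _ := by ring
  refine le_of_mul_le_mul_left ?_ h0
  linarith

theorem IsCubicSolution.posSemidef (hA : A.IsSymm) (hρ : 0 ≤ ρ) (hs : IsCubicSolution A b ρ s)
    (u : EuclideanSpace ℝ (Fin d)) : 0 ≤ inner ℝ u (toEnd A u + (ρ * ‖s‖) • u) := by
  have hG : toEnd A s + (ρ * ‖s‖) • s + b = 0 := by rw [hs.stationary hA hρ]; simp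
  have key : ∀ u, 0 ≤ 1 / 2 * inner ℝ u (toEnd A u + (ρ * ‖s‖) • u)
      + ρ * (‖s + u‖ - ‖s‖) ^ 2 * (2 * ‖s + u‖ + ‖s‖) / 6 := by
    intro u
    have h2 := cubicObjective_sub hA b ρ s u
    rw [hG, inner_zero_left] at h2
    have := hs (s + u)
    linarith
  have hsmul : ∀ (τ : ℝ) u, inner ℝ (τ • u) (toEnd A (τ • u) + (ρ * ‖s‖) • (τ • u))
      = τ ^ 2 * inner ℝ u (toEnd A u + (ρ * ‖s‖) • u) := by
    intro τ u
    have : toEnd A (τ • u) + (ρ * ‖s‖) • (τ • u) = τ • (toEnd A u + (ρ * ‖s‖) • u) := by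
      rw [map_smul]; module
    rw [this, real_inner_smul_left, real_inner_smul_right]; ring
  rcases eq_or_ne s 0 with hs0 | hs0
  · suffices -inner ℝ u (toEnd A u + (ρ * ‖s‖) • u) ≤ 0 by linarith
    refine nonpos_of_forall_le_mul (c := 2 * (ρ * ‖u‖ ^ 2 * (2 * ‖u‖) / 6)) fun τ h0 h1 => ?_
    have h2 := key (τ • u)
    have h3 := cubic_remainder_le hρ s (τ • u)
    rw [hsmul] at h2
    rw [norm_smul, Real.norm_of_nonneg h0.le] at h3
    have h4 : ρ * (τ * ‖u‖) ^ 2 * (3 * ‖s‖ + 2 * (τ * ‖u‖)) / 6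
        = τ ^ 2 * ((ρ * ‖u‖ ^ 2 * (2 * ‖u‖) / 6) * τ) := by
      rw [hs0, norm_zero]; ring
    refine le_of_mul_le_mul_left ?_ (sq_pos_of_pos h0)
    linarith
  · have hne : ∀ u, inner ℝ s u ≠ 0 → 0 ≤ inner ℝ u (toEnd A u + (ρ * ‖s‖) • u) := by
      intro u hu
      have hu0 : ‖u‖ ≠ 0 := by
        intro h; rw [norm_eq_zero] at h; simp [h] at hu
      set τ := -2 * inner ℝ s u / ‖u‖ ^ 2 with hτ
      have hτ0 : τ ≠ 0 := div_ne_zero (mul_ne_zero (by norm_num) hu) (pow_ne_zero 2 hu0)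
      have hn : ‖s + τ • u‖ = ‖s‖ := by
        rw [← sq_eq_sq₀ (norm_nonneg _) (norm_nonneg _), norm_add_sq_real, norm_smul, mul_pow,
          Real.norm_eq_abs, sq_abs, real_inner_smul_right, hτ]
        field_simp
        ring
      have h2 := key (τ • u)
      rw [hsmul, hn, sub_self] at h2
      have : 0 < τ ^ 2 := by positivity
      by_contra! hneg
      nlinarith
    by_cases hu : inner ℝ s u = 0
    · suffices -inner ℝ u (toEnd A u + (ρ * ‖s‖) • u) ≤ 0 by linarith
      set Q := inner ℝ s (toEnd A s + (ρ * ‖s‖) • s)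
      set P := inner ℝ s (toEnd A u + (ρ * ‖s‖) • u) + inner ℝ u (toEnd A s + (ρ * ‖s‖) • s)
      refine nonpos_of_forall_le_mul (c := P + |Q|) fun τ h0 h1 => ?_
      have h2 := hne (u + τ • s) (by
        rw [inner_add_right, hu, real_inner_smul_right, zero_add]
        exact mul_ne_zero h0.ne' (inner_self_ne_zero.mpr hs0))
      have e : inner ℝ (u + τ • s) (toEnd A (u + τ • s) + (ρ * ‖s‖) • (u + τ • s))
          = inner ℝ u (toEnd A u + (ρ * ‖s‖) • u) + τ * P + τ ^ 2 * Q := by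
        have : toEnd A (u + τ • s) + (ρ * ‖s‖) • (u + τ • s)
            = (toEnd A u + (ρ * ‖s‖) • u) + τ • (toEnd A s + (ρ * ‖s‖) • s) := by
          rw [map_add, map_smul]; module
        rw [this, inner_add_left, inner_add_right (𝕜 := ℝ) u, inner_add_right (𝕜 := ℝ) (τ • s),
          real_inner_smul_left, real_inner_smul_left, real_inner_smul_right,
          real_inner_smul_right]
        ring
      rw [e] at h2
      have h3 : τ ^ 2 * Q ≤ τ * |Q| := by
        have h4 : τ ^ 2 * Q ≤ τ ^ 2 * |Q| := by gcongr; exact le_abs_self Q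
        have h5 : τ ^ 2 * |Q| ≤ τ * |Q| := by
          gcongr; nlinarith
        linarith
      linarith
    · exact hne u hu

theorem inner_aeval_shift (hA : A.IsSymm) (p : ℝ[X]) (c : ℝ) (v : EuclideanSpace ℝ (Fin d)) :
    inner ℝ (aeval (toEnd A) p v) (toEnd A (aeval (toEnd A) p v) + c • aeval (toEnd A) p v)
      = inner ℝ v (aeval (toEnd A) (p * ((X + C c) * p)) v) := by
  rw [← inner_aeval_aeval (toEnd_isSymmetric hA)]
  simp

theorem IsCubicSolution.linear_rate (hd : 0 < d) (hA : A.IsSymm) (hρ : 0 ≤ ρ)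
    (hs : IsCubicSolution A b ρ s) {t : ℕ} (ht : 0 < t) {x : EuclideanSpace ℝ (Fin d)}
    (hx : IsKrylovCubicSolution A b ρ t x) :
    cubicObjective A b ρ x - cubicObjective A b ρ s ≤
      36 * (cubicObjective A b ρ 0 - cubicObjective A b ρ s) *
        Real.exp (-4 * (t : ℝ) *
          √((minEigenvalue A + ρ * ‖s‖) / (maxEigenvalue A + ρ * ‖s‖))) := by
  have hst := hs.stationary hA hρ
  have hpsd := hs.posSemidef hA hρ
  have hmM := minEigenvalue_le_maxEigenvalue hd hA
  have hmu := minEigenvalue_add_nonneg hd hA hpsd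
  have hG : toEnd A s + (ρ * ‖s‖) • s + b = 0 := by rw [hst]; simp
  set lam := ρ * ‖s‖ with hlam
  set u := √((minEigenvalue A + lam) / (maxEigenvalue A + lam)) with hu
  have hx0 := hx.2 0 (Submodule.zero_mem _)
  have hΔ : 0 ≤ cubicObjective A b ρ 0 - cubicObjective A b ρ s := by linarith [hs 0]
  set ε := 2 * Real.exp (-2 * t * u) with hε
  have hε0 : 0 < ε := by positivity
  have hexp : 36 * Real.exp (-4 * t * u) = 9 * ε ^ 2 := by
    rw [hε, mul_pow, ← Real.exp_nat_mul]
    ring_nf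
  suffices cubicObjective A b ρ x - cubicObjective A b ρ s ≤
      9 * ε ^ 2 * (cubicObjective A b ρ 0 - cubicObjective A b ρ s) by
    rw [← hexp] at this; linarith
  rcases lt_or_ge (1 / 3) ε with hε1 | hε1
  · have : 1 ≤ 9 * ε ^ 2 := by nlinarith
    nlinarith
  rcases eq_or_ne s 0 with rfl | hs0
  · nlinarith [mul_nonneg (show (0 : ℝ) ≤ 9 * ε ^ 2 by positivity) hΔ]
  have hsn : 0 < ‖s‖ := norm_pos_iff.mpr hs0
  have hmu0 : 0 < minEigenvalue A + lam := by
    rcases hmu.eq_or_lt with h | h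
    · rw [hu, ← h] at hε
      simp at hε
      linarith
    · exact h
  obtain ⟨r, hrd, hr1, hr⟩ := exists_chebyshev_small _ _ lam hmM hmu0 ht
  rw [← hu, ← hε] at hr
  set e := aeval (toEnd A) r s with he
  have hen : ‖e‖ ≤ ε * ‖s‖ := by
    rw [← sq_le_sq₀ (norm_nonneg _) (by positivity), he, norm_sq_aeval (toEnd_isSymmetric hA),
      mul_pow]
    refine inner_aeval_le_const hA _ _ (fun z h1 h2 => ?_) s
    rw [eval_mul, ← sq, ← sq_abs]
    exact pow_le_pow_left₀ (abs_nonneg _) (hr z h1 h2) 2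
  set y := s - e with hy
  have hyK : y ∈ krylovSubspace A b t := sub_aeval_mem_krylovSubspace hst ht hrd hr1
  have hye : |‖s‖ - ‖y‖| ≤ ε * ‖s‖ := by
    refine (abs_norm_sub_norm_le s y).trans ?_
    rwa [hy, sub_sub_cancel]
  have hyl : 2 / 3 * ‖s‖ ≤ ‖y‖ := by
    have := (abs_le.mp hye).2
    nlinarith
  have hy0 : 0 < ‖y‖ := by linarith
  set α := ‖s‖ / ‖y‖ with hα
  have hα0 : 0 < α := by positivity
  have hα1 : α ≤ 3 / 2 := by rw [hα, div_le_iff₀ hy0]; linarith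
  have hα2 : |α - 1| ≤ 3 / 2 * ε := by
    have : α - 1 = (‖s‖ - ‖y‖) / ‖y‖ := by rw [hα]; field_simp
    rw [this, abs_div, abs_of_pos hy0, div_le_iff₀ hy0]
    nlinarith
  have hxy := hx.2 (α • y) (Submodule.smul_mem _ _ hyK)
  set P : ℝ[X] := C (α - 1) - C α * r with hP
  have hPs : α • y = s + aeval (toEnd A) P s := by
    rw [hP, hy, he]
    simp
    module
  have hn : ‖s + aeval (toEnd A) P s‖ = ‖s‖ := by
    rw [← hPs, norm_smul, Real.norm_of_nonneg hα0.le, hα]; field_simp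
  have h1 := cubicObjective_sub hA b ρ s (aeval (toEnd A) P s)
  rw [← hlam, hG, inner_zero_left, hn, sub_self, inner_aeval_shift hA, ← hPs] at h1
  have h2 : inner ℝ s (aeval (toEnd A) (P * ((X + C lam) * P)) s)
      ≤ inner ℝ s (aeval (toEnd A) (C (9 * ε ^ 2) * (X + C lam)) s) := by
    refine inner_aeval_le hA _ _ (fun z hz1 hz2 => ?_) s
    simp only [hP, eval_mul, eval_add, eval_sub, eval_C, eval_X]
    have h3 := hr z hz1 hz2
    have h4 : |α - 1 - α * eval z r| ≤ 3 * ε := by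
      have h5 : |α * eval z r| ≤ 3 / 2 * ε := by
        rw [abs_mul, abs_of_pos hα0]
        exact mul_le_mul hα1 h3 (abs_nonneg _) (by norm_num)
      have := abs_sub (α - 1) (α * eval z r)
      linarith
    have h5 := pow_le_pow_left₀ (abs_nonneg _) h4 2
    rw [sq_abs] at h5
    have h6 : 0 ≤ z + lam := by linarith
    nlinarith
  have h3 : inner ℝ s (aeval (toEnd A) (C (9 * ε ^ 2) * (X + C lam)) s)
      = 9 * ε ^ 2 * inner ℝ s (toEnd A s + lam • s) := by
    rw [← real_inner_smul_right, map_mul, aeval_C, Module.End.mul_apply,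
      Module.algebraMap_end_apply]
    simp
  have h4 := cubicObjective_sub hA b ρ s (-s)
  rw [← hlam, hG, inner_zero_left, add_neg_cancel, norm_zero, map_neg, smul_neg, ← neg_add,
    inner_neg_neg] at h4
  have h5 : 0 ≤ ρ * (0 - ‖s‖) ^ 2 * (2 * 0 + ‖s‖) / 6 := by positivity
  have h6 : 1 / 2 * inner ℝ s (toEnd A s + lam • s) ≤
      cubicObjective A b ρ 0 - cubicObjective A b ρ s := by linarith
  have h7 := mul_le_mul_of_nonneg_left h6 (show (0 : ℝ) ≤ 9 * ε ^ 2 by positivity)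
  rw [h3] at h2
  linarith

/-- The quadratic objective, shifted so that it becomes convex. -/
def convexObjective (A : Matrix (Fin d) (Fin d) ℝ) (b x : EuclideanSpace ℝ (Fin d)) : ℝ :=
  quadObjective A b x - minEigenvalue A / 2 * ‖x‖ ^ 2

theorem convexObjective_add (hA : A.IsSymm) (x u : EuclideanSpace ℝ (Fin d)) :
    convexObjective A b (x + u) = convexObjective A b x
      + inner ℝ (toEnd A x - minEigenvalue A • x + b) u
      + 1 / 2 * inner ℝ u (toEnd A u - minEigenvalue A • u) := by
  have h1 := norm_add_sq_real x u
  have h2 : inner ℝ u (toEnd A x) = inner ℝ (toEnd A x) u := real_inner_comm _ _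
  have h3 : inner ℝ x (toEnd A u) = inner ℝ (toEnd A x) u := (toEnd_isSymmetric hA x u).symm
  simp only [convexObjective, quadObjective, map_add, inner_add_left, inner_add_right,
    inner_sub_left, inner_sub_right,
    real_inner_smul_left, real_inner_smul_right, real_inner_self_eq_norm_sq] at *
  rw [h2, h3]
  linear_combination (-minEigenvalue A / 2) * h1

theorem cubicObjective_eq (x : EuclideanSpace ℝ (Fin d)) :
    cubicObjective A b ρ x =
      convexObjective A b x + (minEigenvalue A / 2 * ‖x‖ ^ 2 + ρ / 3 * ‖x‖ ^ 3) := by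
  rw [cubicObjective, convexObjective]; ring

/-- A Krylov vector in the ball of radius `‖s‖` that is nearly optimal for the shifted problem. -/
theorem exists_krylov_convex_approx (hA : A.IsSymm) {lam : ℝ}
    (hst : toEnd A s + lam • s = -b) (hmu : 0 ≤ minEigenvalue A + lam) {L : ℝ} (hL : 0 < L)
    (hML : maxEigenvalue A - minEigenvalue A ≤ L) {t : ℕ} (ht : 0 < t) :
    ∃ y ∈ krylovSubspace A b t, ‖y‖ ≤ ‖s‖ ∧
      convexObjective A b y - convexObjective A b s ≤
        4 * L / ((t : ℝ) - 1 / 2) ^ 2 * ‖s‖ ^ 2 := by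
  obtain ⟨r, hrd, hr1, hr⟩ := exists_fejer_polynomial _ _ lam L hL hML hmu ht
  refine ⟨_, sub_aeval_mem_krylovSubspace hst ht hrd hr1, ?_, ?_⟩
  · rw [← sq_le_sq₀ (norm_nonneg _) (norm_nonneg _)]
    have : s - aeval (toEnd A) r s = aeval (toEnd A) (1 - r) s := by simp
    rw [this, norm_sq_aeval (toEnd_isSymmetric hA)]
    have := inner_aeval_le_const hA ((1 - r) * (1 - r)) 1 (fun z h1 h2 => by
      obtain ⟨h3, h4, -⟩ := hr z h1 h2
      simp only [eval_mul, eval_sub, eval_one]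
      nlinarith) s
    rwa [one_mul] at this
  · have e : s - aeval (toEnd A) r s = s + aeval (toEnd A) (-r) s := by simp [sub_eq_add_neg]
    have hg : toEnd A s - minEigenvalue A • s + b = -(minEigenvalue A + lam) • s := by
      rw [← neg_eq_iff_eq_neg.mpr hst]; module
    have h1 := inner_aeval_shift hA (-r) (-minEigenvalue A) s
    rw [neg_smul, ← sub_eq_add_neg] at h1
    rw [e, convexObjective_add hA, hg, h1, real_inner_smul_left]
    have h2 := inner_aeval_le_const hA
      (C (-(minEigenvalue A + lam)) * -r + C (1 / 2) * (-r * ((X + C (-minEigenvalue A)) * -r)))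
      (4 * L / ((t : ℝ) - 1 / 2) ^ 2) (fun z h1 h2 => by
        obtain ⟨h3, h4, h5⟩ := hr z h1 h2
        refine le_trans ?_ h5
        simp only [eval_mul, eval_add, eval_neg, eval_C, eval_X]
        have h6 : (z - minEigenvalue A) * (eval z r * eval z r)
            ≤ (z - minEigenvalue A) * (eval z r * 1) := by
          gcongr
        have h7 : 0 ≤ (z - minEigenvalue A) * eval z r := mul_nonneg (by linarith) h3
        linarith) s
    refine le_trans (le_of_eq ?_) h2
    rw [map_add, LinearMap.add_apply, inner_add_right, map_mul (aeval (toEnd A)) (C _),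
      map_mul (aeval (toEnd A)) (C (1 / 2)), aeval_C, aeval_C, Module.End.mul_apply,
      Module.End.mul_apply, Module.algebraMap_end_apply, Module.algebraMap_end_apply,
      real_inner_smul_right, real_inner_smul_right]
    ring

/-- A Krylov vector with small Rayleigh quotient. -/
theorem exists_krylov_rayleigh (hA : A.IsSymm) {L : ℝ} (hL : 0 < L)
    (hML : maxEigenvalue A - minEigenvalue A ≤ L) {t : ℕ} (ht : 0 < t)
    {v : EuclideanSpace ℝ (Fin d)} (hv : ‖v‖ = 1)
    (hvA : toEnd A v = minEigenvalue A • v) (hvb : inner ℝ v b ≠ 0) :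
    ∃ z ∈ krylovSubspace A b t, z ≠ 0 ∧
      inner ℝ z (toEnd A z - minEigenvalue A • z) ≤
        L * Real.log (4 * ‖b‖ ^ 2 / inner ℝ v b ^ 2) ^ 2 / (16 * ((t : ℝ) - 1 / 2) ^ 2)
          * ‖z‖ ^ 2 := by
  set c := inner ℝ v b with hc
  have hc2 : 0 < c ^ 2 := by positivity
  have hβ : 1 ≤ ‖b‖ ^ 2 / c ^ 2 := by
    rw [one_le_div hc2, ← sq_abs c]
    refine pow_le_pow_left₀ (abs_nonneg _) ?_ 2
    simpa [hv] using abs_real_inner_le_norm v b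
  obtain ⟨δ, hδ, p, hpd, hp0, hpm, hp⟩ := exists_amplifying_polynomial
    (minEigenvalue A) (maxEigenvalue A) L _ hL hML hβ ht
  rw [← mul_div_assoc] at hδ
  refine ⟨aeval (toEnd A) p b, aeval_mem_krylovSubspace A b hpd, ?_, ?_⟩
  · intro h
    have h1 : inner ℝ v (aeval (toEnd A) p b) = p.eval (minEigenvalue A) * c := by
      rw [← isSymmetric_aeval (toEnd_isSymmetric hA), aeval_apply_of_eigen _ hvA,
        real_inner_smul_left]
    rw [h, inner_zero_right] at h1
    exact mul_ne_zero hp0 hvb h1.symm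
  · set z := aeval (toEnd A) p b with hz
    suffices inner ℝ z (toEnd A z + (-(minEigenvalue A + δ)) • z) ≤ 0 by
      have e : inner ℝ z (toEnd A z + (-(minEigenvalue A + δ)) • z)
          = inner ℝ z (toEnd A z - minEigenvalue A • z) - δ * ‖z‖ ^ 2 := by
        simp only [inner_add_right, inner_sub_right, real_inner_smul_right,
          real_inner_self_eq_norm_sq]
        ring
      rw [e] at this
      have := mul_le_mul_of_nonneg_right hδ (sq_nonneg ‖z‖)
      linarith
    rw [hz, inner_aeval_shift hA]
    set φ : ℝ[X] := p * ((X + C (-(minEigenvalue A + δ))) * p) with hφ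
    have hφe : ∀ x, φ.eval x = (x - minEigenvalue A - δ) * p.eval x ^ 2 := by
      intro x; simp [hφ]; ring
    set b' := b - c • v with hb'
    have hb : b = c • v + b' := by rw [hb']; abel
    have hvb' : inner ℝ v b' = 0 := by
      rw [hb', inner_sub_right, real_inner_smul_right, real_inner_self_eq_norm_sq, hv, ← hc]
      ring
    have hbn : ‖b‖ ^ 2 = c ^ 2 + ‖b'‖ ^ 2 := by
      rw [hb, norm_add_sq_real, norm_smul, real_inner_smul_left, hvb', hv, mul_one,
        Real.norm_eq_abs, sq_abs]
      ring
    have h1 := aeval_apply_of_eigen (toEnd A) hvA φ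
    have h2 : inner ℝ v (aeval (toEnd A) φ b') = 0 := by
      rw [← isSymmetric_aeval (toEnd_isSymmetric hA), h1, real_inner_smul_left, hvb', mul_zero]
    have h3 := inner_aeval_le_const hA φ 1 (fun x hx1 hx2 => by rw [hφe]; exact hp x hx1 hx2) b'
    have h4 : inner ℝ b (aeval (toEnd A) φ b)
        = c ^ 2 * φ.eval (minEigenvalue A) + inner ℝ b' (aeval (toEnd A) φ b') := by
      rw [hb, map_add, map_smul, h1]
      simp only [inner_add_left, inner_add_right, real_inner_smul_left, real_inner_smul_right, h2,
        real_inner_comm v b', hvb', real_inner_self_eq_norm_sq, hv]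
      ring
    rw [h4, hφe]
    have h5 := mul_le_mul_of_nonneg_left hpm hc2.le
    have h6 : c ^ 2 * (1 - ‖b‖ ^ 2 / c ^ 2) = -‖b'‖ ^ 2 := by
      rw [hbn]; field_simp; ring
    linarith

/-- A point of the ball can be moved to the sphere along a line, in the direction in which a given
linear functional does not increase. -/
theorem exists_norm_add_smul_eq {E : Type*} [NormedAddCommGroup E] [NormedSpace ℝ E] {y z : E}
    {R : ℝ} (hy : ‖y‖ ≤ R) (hz : z ≠ 0) (c : ℝ) :
    ∃ α : ℝ, ‖y + α • z‖ = R ∧ α * c ≤ 0 ∧ α ^ 2 * ‖z‖ ^ 2 ≤ 4 * R ^ 2 := by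
  have hR : 0 ≤ R := (norm_nonneg _).trans hy
  have key : ∀ w : E, w ≠ 0 → ∃ α : ℝ, 0 ≤ α ∧ ‖y + α • w‖ = R ∧
      α ^ 2 * ‖w‖ ^ 2 ≤ 4 * R ^ 2 := by
    intro w hw
    have hwn : 0 < ‖w‖ := norm_pos_iff.mpr hw
    have hR2 : 0 ≤ 2 * R / ‖w‖ := by positivity
    have hcont : ContinuousOn (fun α : ℝ => ‖y + α • w‖) (Set.Icc 0 (2 * R / ‖w‖)) := by fun_prop
    have hend : R ≤ ‖y + (2 * R / ‖w‖) • w‖ := by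
      have h1 := norm_sub_norm_le ((2 * R / ‖w‖) • w) (-y)
      rw [norm_smul, Real.norm_of_nonneg hR2, norm_neg, sub_neg_eq_add, add_comm _ y,
        div_mul_cancel₀ _ hwn.ne'] at h1
      linarith
    obtain ⟨α, hα, hα2⟩ := intermediate_value_Icc hR2 hcont ⟨by simpa using hy, hend⟩
    refine ⟨α, hα.1, hα2, ?_⟩
    have h1 : α * ‖w‖ ≤ 2 * R := (le_div_iff₀ hwn).mp hα.2
    have h2 := pow_le_pow_left₀ (mul_nonneg hα.1 hwn.le) h1 2
    linarith
  rcases le_total c 0 with hc | hc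
  · obtain ⟨α, h0, h1, h2⟩ := key z hz
    exact ⟨α, h1, mul_nonpos_of_nonneg_of_nonpos h0 hc, h2⟩
  · obtain ⟨α, h0, h1, h2⟩ := key (-z) (neg_ne_zero.mpr hz)
    refine ⟨-α, ?_, ?_, ?_⟩
    · rwa [neg_smul, ← smul_neg]
    · rw [neg_mul]; exact neg_nonpos.mpr (mul_nonneg h0 hc)
    · rwa [neg_sq, ← norm_neg z]

theorem le_mul_of_forall_lt {a c x : ℝ} (h : ∀ L, a < L → x ≤ L * c) : x ≤ a * c := by
  have h1 : Filter.Tendsto (fun L : ℝ => L * c) (nhdsWithin a (Set.Ioi a)) (nhds (a * c)) :=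
    ((continuous_id.mul continuous_const).tendsto a).mono_left nhdsWithin_le_nhds
  exact ge_of_tendsto h1 (Filter.eventually_of_mem self_mem_nhdsWithin fun L hL => h L hL)

theorem IsCubicSolution.sublinear_rate (hd : 0 < d) (hA : A.IsSymm) (hρ : 0 ≤ ρ)
    (hs : IsCubicSolution A b ρ s) {t : ℕ} (ht : 0 < t) {x : EuclideanSpace ℝ (Fin d)}
    (hx : IsKrylovCubicSolution A b ρ t x) {v : EuclideanSpace ℝ (Fin d)} (hv : ‖v‖ = 1)
    (hvA : toEnd A v = minEigenvalue A • v) (hvb : minEigenvalue A < 0 → inner ℝ v b ≠ 0) :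
    cubicObjective A b ρ x - cubicObjective A b ρ s ≤
      (maxEigenvalue A - minEigenvalue A) * ‖s‖ ^ 2 / ((t : ℝ) - 1 / 2) ^ 2 *
        (4 + (if minEigenvalue A < 0 then (1 : ℝ) else 0) / 8 *
          Real.log (4 * ‖b‖ ^ 2 / inner ℝ v b ^ 2) ^ 2) := by
  have hst := hs.stationary hA hρ
  have hmu := minEigenvalue_add_nonneg hd hA (hs.posSemidef hA hρ)
  have hmM := minEigenvalue_le_maxEigenvalue hd hA
  have hτ : (t : ℝ) - 1 / 2 ≠ 0 := by
    have : (1 : ℝ) ≤ t := by exact_mod_cast ht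
    linarith
  rw [mul_div_assoc, mul_assoc]
  refine le_mul_of_forall_lt fun L hL => ?_
  have hL0 : 0 < L := by linarith
  obtain ⟨y, hyK, hyn, hy⟩ := exists_krylov_convex_approx hA hst hmu hL0 hL.le ht
  split_ifs with hneg
  · obtain ⟨z, hzK, hz0, hz⟩ := exists_krylov_rayleigh hA hL0 hL.le ht hv hvA (hvb hneg)
    obtain ⟨α, hα1, hα2, hα3⟩ := exists_norm_add_smul_eq hyn hz0
      (inner ℝ (toEnd A y - minEigenvalue A • y + b) z)
    have hxy := hx.2 _ (Submodule.add_mem _ hyK (Submodule.smul_mem _ α hzK))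
    have h1 := cubicObjective_eq (A := A) (b := b) (ρ := ρ) (y + α • z)
    rw [hα1] at h1
    have h2 := cubicObjective_eq (A := A) (b := b) (ρ := ρ) s
    have h3 := convexObjective_add (b := b) hA y (α • z)
    rw [map_smul, smul_comm _ α z, ← smul_sub, real_inner_smul_left, real_inner_smul_right,
      real_inner_smul_right] at h3
    set l := Real.log (4 * ‖b‖ ^ 2 / inner ℝ v b ^ 2)
    have h4 := mul_le_mul_of_nonneg_left hz (sq_nonneg α)
    have h5 : L * l ^ 2 / (16 * ((t : ℝ) - 1 / 2) ^ 2) * (α ^ 2 * ‖z‖ ^ 2)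
        ≤ L * l ^ 2 / (16 * ((t : ℝ) - 1 / 2) ^ 2) * (4 * ‖s‖ ^ 2) := by
      gcongr
    have h6 : L * (‖s‖ ^ 2 / ((t : ℝ) - 1 / 2) ^ 2 * (4 + 1 / 8 * l ^ 2))
        = 4 * L / ((t : ℝ) - 1 / 2) ^ 2 * ‖s‖ ^ 2
          + 1 / 2 * (L * l ^ 2 / (16 * ((t : ℝ) - 1 / 2) ^ 2) * (4 * ‖s‖ ^ 2)) := by
      field_simp
      ring
    rw [h6]
    linarith
  · have hxy := hx.2 y hyK
    have h1 := cubicObjective_eq (A := A) (b := b) (ρ := ρ) y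
    have h2 := cubicObjective_eq (A := A) (b := b) (ρ := ρ) s
    have h3 : minEigenvalue A / 2 * ‖y‖ ^ 2 + ρ / 3 * ‖y‖ ^ 3
        ≤ minEigenvalue A / 2 * ‖s‖ ^ 2 + ρ / 3 * ‖s‖ ^ 3 := by
      have : 0 ≤ minEigenvalue A := not_lt.mp hneg
      gcongr
    have h4 : L * (‖s‖ ^ 2 / ((t : ℝ) - 1 / 2) ^ 2 *
        (4 + 0 / 8 * Real.log (4 * ‖b‖ ^ 2 / inner ℝ v b ^ 2) ^ 2))
        = 4 * L / ((t : ℝ) - 1 / 2) ^ 2 * ‖s‖ ^ 2 := by ring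
    rw [h4]
    linarith

end

end KrylovCubic

theorem corollary4p2 {d : ℕ} (hd : 0 < d) (A : Matrix (Fin d) (Fin d) ℝ) (hA : A.IsSymm)
    (b : EuclideanSpace ℝ (Fin d)) (ρ : ℝ) (hρ : 0 ≤ ρ)
    (s : EuclideanSpace ℝ (Fin d)) (hs : KrylovCubic.IsCubicSolution A b ρ s)
    (t : ℕ) (ht : 0 < t)
    (x : EuclideanSpace ℝ (Fin d)) (hx : KrylovCubic.IsKrylovCubicSolution A b ρ t x) :
    KrylovCubic.cubicObjective A b ρ x - KrylovCubic.cubicObjective A b ρ s ≤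
        36 * (KrylovCubic.cubicObjective A b ρ 0 - KrylovCubic.cubicObjective A b ρ s) *
          Real.exp (-4 * (t : ℝ) *
            √((KrylovCubic.minEigenvalue A + ρ * ‖s‖) / (KrylovCubic.maxEigenvalue A + ρ * ‖s‖))) ∧
    ∀ v : EuclideanSpace ℝ (Fin d), ‖v‖ = 1 →
      A.toEuclideanLin v = KrylovCubic.minEigenvalue A • v →
      (KrylovCubic.minEigenvalue A < 0 → inner ℝ v b ≠ 0) →
      KrylovCubic.cubicObjective A b ρ x - KrylovCubic.cubicObjective A b ρ s ≤
        (KrylovCubic.maxEigenvalue A - KrylovCubic.minEigenvalue A) * ‖s‖ ^ 2 /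
            ((t : ℝ) - 1 / 2) ^ 2 *
          (4 + (if KrylovCubic.minEigenvalue A < 0 then (1 : ℝ) else 0) / 8 *
            Real.log (4 * ‖b‖ ^ 2 / inner ℝ v b ^ 2) ^ 2) := by
  exact ⟨hs.linear_rate hd hA hρ ht hx,
    fun v hv hvA hvb => hs.sublinear_rate hd hA hρ ht hx hv hvA hvb⟩
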